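/- Let $d\ge 3$ and $1\le k<d$. Let $\mathcal G_{k,d}=\{P\in\mathbb R^{d\times d}: P^\top=P,\ P^2=P,\ \operatorname{trace}(P)=k\}$, and let $\sigma_{k,d}$ be the orthogonally invariant Borel probability measure on $\mathcal G_{k,d}$ induced by the Haar measure of the orthogonal group $\mathcal O(d)$ through $P\mapsto UPU^\top$. For $t\in\mathbb N$ let $\mathrm{Pol}^2_t(\mathcal G_{k,d})$ be the real span of the functions $P\mapsto \operatorname{trace}(MP)^s$ on $\mathcal G_{k,d}$, where $M\in\mathbb R^{d\times d}$ is symmetric with $\operatorname{rank}(M)\le 2$ and $0\le s\le t$. For $P_1,\dots,P_n\in\mathcal G_{k,d}$ and $\omega_1,\dots,\omega_n\in\mathbb R$, the family $\{(P_j,\omega_j)\}_{j=1}^n$ is a cubature for $\mathrm{Pol}^2_t(\mathcal G_{k,d})$ if $\sum_{j=1}^n\omega_j f(P_j)=\int f\,d\sigma_{k,d}$ for all $f\in \mathrm{Pol}^2_t(\mathcal G_{k,d})$. Let $X$ be a random vector with values in the unit sphere $\mathbb S^{d-1}\subset\mathbb R^d$. (i) If $\{(P_j,\omega_j)\}_{j=1}^n$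 is a cubature for $\mathrm{Pol}^2_1(\mathcal G_{k,d})$, then for $i=1,\dots,d$ $$\mathbb E X_i=A_1\sum_{j=1}^n\omega_j\,\mathbb E(P_jX)_i,\qquad A_1=\frac dk. \tag{1}$$ (ii) If $\{(P_j,\omega_j)\}_{j=1}^n$ is a cubature for $\mathrm{Pol}^2_2(\mathcal G_{k,d})$, then (1) holds and, for $i,\ell=1,\dots,d$, $$\mathbb E X_iX_\ell=A_2\sum_{j=1}^n\omega_j\,\mathbb E(P_jX)_i(P_jX)_\ell-B_2\frac kd\,\delta_{i,\ell}, \tag{2}$$ where $$A_2=\frac{(d-1)d(d+2)}{k(dk+d-2)},\qquad B_2=\frac{(d-k)d}{kd(k+1)-2k}.$$ (iii) If $\{(P_j,\omega_j)\}_{j=1}^n$ is a cubature for $\mathrm{Pol}^2_3(\mathcal G_{k,d})$, then (1) and (2) hold and, for $i,\ell,m=1,\dots,d$, $$\mathbb E X_iX_\ell X_m=A_3\sum_{j=1}^n\omega_j\,\mathbb E(P_jX)_i(P_jX)_\ell(P_jX)_m-\frac{B_3}{3}\,\frac kd\sum_{j=1}^n\omega_j\big(\mathbb E(P_jX)_i\,\delta_{\ell,m}+\mathbb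 E(P_jX)_\ell\,\delta_{i,m}+\mathbb E(P_jX)_m\,\delta_{i,\ell}\big),$$ where $$A_3=\frac{(d-2)(d-1)d(d+2)(d+4)}{k(d^2k^2+3d^2k+2d^2-6dk-12d-4k^2+16)},$$ $$B_3=\frac{3d^2(d^2k+2d^2-dk^2-4dk-4d+2k^2+4k)}{k^2(d^2k^2+3d^2k+2d^2-6dk-12d-4k^2+16)}.$$ -/

import Mathlib

open MeasureTheory

namespace MomentFusion

/-- The Grassmann space `G_{k,d}`: symmetric idempotent real `d × d` matrices of trace `k`,
that is, the orthogonal projectors on `ℝ^d` of rank `k`. -/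
def Grassmannian (k d : ℕ) : Type :=
  {P : Matrix (Fin d) (Fin d) ℝ // P.IsSymm ∧ P * P = P ∧ P.trace = (k : ℝ)}

instance (k d : ℕ) : TopologicalSpace (Grassmannian k d) :=
  inferInstanceAs (TopologicalSpace
    {P : Matrix (Fin d) (Fin d) ℝ // P.IsSymm ∧ P * P = P ∧ P.trace = (k : ℝ)})

instance (k d : ℕ) : MeasurableSpace (Grassmannian k d) := borel _

instance (k d : ℕ) : BorelSpace (Grassmannian k d) := ⟨rfl⟩

/-- The diagonal projector `D_k` with `k` ones followed by zeros. -/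
def diagProj {k d : ℕ} (h : k ≤ d) : Grassmannian k d :=
  ⟨Matrix.diagonal fun i : Fin d => if (i : ℕ) < k then 1 else 0, by
    refine ⟨Matrix.isSymm_diagonal _, ?_, ?_⟩
    · rw [Matrix.diagonal_mul_diagonal]
      congr 1
      funext i
      split_ifs <;> simp
    · rw [Matrix.trace_diagonal, Finset.sum_boole, Fin.card_filter_val_lt, min_eq_right h]⟩

/-- The action of the orthogonal group by conjugation, `P ↦ U P Uᵀ`. -/
def conj {k d : ℕ} (U : Matrix.orthogonalGroup (Fin d) ℝ) (P : Grassmannian k d) :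
    Grassmannian k d :=
  ⟨(U : Matrix (Fin d) (Fin d) ℝ) * P.1 * (U : Matrix (Fin d) (Fin d) ℝ).transpose, by
    obtain ⟨P, hs, hi, ht⟩ := P
    have hU : (U : Matrix (Fin d) (Fin d) ℝ).transpose * (U : Matrix (Fin d) (Fin d) ℝ) = 1 := by
      simpa [Matrix.star_eq_conjTranspose] using Matrix.UnitaryGroup.star_mul_self U
    refine ⟨?_, ?_, ?_⟩
    · unfold Matrix.IsSymm at *
      simp [Matrix.transpose_mul, hs, Matrix.mul_assoc]
    · calc _ = (U : Matrix (Fin d) (Fin d) ℝ) * P *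
            ((U : Matrix (Fin d) (Fin d) ℝ).transpose * (U : Matrix (Fin d) (Fin d) ℝ)) * P *
            (U : Matrix (Fin d) (Fin d) ℝ).transpose := by simp only [Matrix.mul_assoc]
        _ = (U : Matrix (Fin d) (Fin d) ℝ) * P * (U : Matrix (Fin d) (Fin d) ℝ).transpose := by
            rw [hU, Matrix.mul_one, Matrix.mul_assoc (U : Matrix (Fin d) (Fin d) ℝ) P P, hi]
    · rw [Matrix.trace_mul_comm, ← Matrix.mul_assoc, hU, Matrix.one_mul, ht]⟩

instance (d : ℕ) : MeasurableSpace (Matrix.orthogonalGroup (Fin d) ℝ) := borel _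

instance (d : ℕ) : BorelSpace (Matrix.orthogonalGroup (Fin d) ℝ) := ⟨rfl⟩

/-- The orthogonal group is compact: it is closed and its matrices have entries in `[-1, 1]`. -/
instance (d : ℕ) : CompactSpace (Matrix.orthogonalGroup (Fin d) ℝ) := by
  apply isCompact_iff_compactSpace.mp
  have hc : IsCompact (Set.univ.pi fun _ : Fin d => Set.univ.pi fun _ : Fin d =>
      Set.Icc (-1 : ℝ) 1) :=
    isCompact_univ_pi fun _ => isCompact_univ_pi fun _ => isCompact_Icc
  refine IsCompact.of_isClosed_subset (X := Matrix (Fin d) (Fin d) ℝ) hc ?_ ?_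
  · have : (Matrix.orthogonalGroup (Fin d) ℝ : Set (Matrix (Fin d) (Fin d) ℝ)) =
        {A | A * A.transpose = 1} := by
      ext A
      exact Matrix.mem_orthogonalGroup_iff (Fin d) ℝ
    rw [this]
    exact isClosed_eq (continuous_id.mul continuous_id.matrix_transpose) continuous_const
  · intro A hA i _ j _
    exact abs_le.mp (entry_norm_bound_of_unitary hA i j)

/-- The normalized Haar measure on `O(d)`. -/
noncomputable def haarO (d : ℕ) : Measure (Matrix.orthogonalGroup (Fin d) ℝ) :=
  Measure.haarMeasure ⊤

/-- The orthogonally invariant probability measure `σ_{k,d}` on `G_{k,d}` induced by the Haar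
measure on `O(d)` through the transitive action by conjugation: the law of `U D_k Uᵀ`. -/
noncomputable def sigma {k d : ℕ} (h : k ≤ d) : Measure (Grassmannian k d) :=
  (haarO d).map fun U => conj U (diagProj h)

/-- The space `Pol^ℓ_t(G_{k,d})`, spanned by the functions `P ↦ ⟨M, P⟩ ^ s = trace (M P) ^ s`
on `G_{k,d}` with `M` symmetric of rank at most `ℓ` and `s ≤ t`. -/
def Pol (k d l t : ℕ) : Submodule ℝ (Grassmannian k d → ℝ) :=
  Submodule.span ℝ {f | ∃ M : Matrix (Fin d) (Fin d) ℝ, M.IsSymm ∧ M.rank ≤ l ∧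
    ∃ s ≤ t, f = fun P => (M * P.1).trace ^ s}

/-- `{(P_j, w_j)}` is a cubature for `Pol^ℓ_t(G_{k,d})`; the weights are arbitrary reals. -/
def IsCubature {k d n : ℕ} (h : k ≤ d) (l t : ℕ) (P : Fin n → Grassmannian k d)
    (w : Fin n → ℝ) : Prop :=
  ∀ f ∈ Pol k d l t, ∑ j, w j * f (P j) = ∫ Q, f Q ∂(sigma h)

/-- The coordinate `(P x)_i` of the projection of `x`. -/
def projCoord {k d : ℕ} (P : Grassmannian k d) (x : EuclideanSpace ℝ (Fin d)) (i : Fin d) : ℝ :=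
  P.1.mulVec x.ofLp i

/-- The Kronecker delta. -/
def delta {d : ℕ} (i j : Fin d) : ℝ := if i = j then 1 else 0

/-- `A₁ = d / k`. -/
noncomputable def A1 (d k : ℝ) : ℝ := d / k

noncomputable def A2 (d k : ℝ) : ℝ :=
  ((d - 1) * d * (d + 2)) / (k * (d * k + d - 2))

noncomputable def B2 (d k : ℝ) : ℝ :=
  ((d - k) * d) / (k * d * (k + 1) - 2 * k)

noncomputable def A3 (d k : ℝ) : ℝ :=
  ((d - 2) * (d - 1) * d * (d + 2) * (d + 4)) /
    (k * (d ^ 2 * k ^ 2 + 3 * d ^ 2 * k + 2 * d ^ 2 - 6 * d * k - 12 * d - 4 * k ^ 2 + 16))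

noncomputable def B3 (d k : ℝ) : ℝ :=
  (3 * d ^ 2 * (d ^ 2 * k + 2 * d ^ 2 - d * k ^ 2 - 4 * d * k - 4 * d + 2 * k ^ 2 + 4 * k)) /
    (k ^ 2 * (d ^ 2 * k ^ 2 + 3 * d ^ 2 * k + 2 * d ^ 2 - 6 * d * k - 12 * d - 4 * k ^ 2 + 16))

/-- The reconstruction formula for all first moments. -/
def FirstMoments {Ω : Type*} [MeasurableSpace Ω] (μ : Measure Ω) {k d n : ℕ}
    (X : Ω → EuclideanSpace ℝ (Fin d)) (P : Fin n → Grassmannian k d) (w : Fin n → ℝ) : Prop :=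
  ∀ i : Fin d, (∫ a, X a i ∂μ : ℝ) = A1 d k * ∑ j, w j * ∫ a, projCoord (P j) (X a) i ∂μ

/-- The reconstruction formula for all second moments. -/
def SecondMoments {Ω : Type*} [MeasurableSpace Ω] (μ : Measure Ω) {k d n : ℕ}
    (X : Ω → EuclideanSpace ℝ (Fin d)) (P : Fin n → Grassmannian k d) (w : Fin n → ℝ) : Prop :=
  ∀ i l : Fin d, (∫ a, X a i * X a l ∂μ : ℝ) =
    A2 d k * ∑ j, w j * ∫ a, projCoord (P j) (X a) i * projCoord (P j) (X a) l ∂μ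
      - B2 d k * ((k : ℝ) / (d : ℝ)) * delta i l

/-- The reconstruction formula for all third moments. -/
def ThirdMoments {Ω : Type*} [MeasurableSpace Ω] (μ : Measure Ω) {k d n : ℕ}
    (X : Ω → EuclideanSpace ℝ (Fin d)) (P : Fin n → Grassmannian k d) (w : Fin n → ℝ) : Prop :=
  ∀ i l m : Fin d, (∫ a, X a i * X a l * X a m ∂μ : ℝ) =
    A3 d k * ∑ j, w j * ∫ a, projCoord (P j) (X a) i * projCoord (P j) (X a) l *
        projCoord (P j) (X a) m ∂μ
      - B3 d k / 3 * ∑ j, w j *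
          ((∫ a, projCoord (P j) (X a) i ∂μ) * delta l m
            + (∫ a, projCoord (P j) (X a) l ∂μ) * delta i m
            + (∫ a, projCoord (P j) (X a) m ∂μ) * delta i l) * ((k : ℝ) / (d : ℝ))

end MomentFusion

namespace MomentFusion

open Matrix

variable {k d n : ℕ}

/-! For fixed unit `x`, the function `Q ↦ (xᵀQy)^s` is the `s`-th power of a trace against a
symmetric matrix of rank at most 2 (`bform_pow_mem_Pol`). The cubature sum of it is therefore its
`σ`-mean, and everything reduces to computing that mean for `s ≤ 3`.

The means follow from three facts: conjugation invariance, `tr Q = k`, and `Q² = Q`, which gives `∑ⱼ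
(xᵀQeⱼ)² = xᵀQx`. Write `y = (x·y)x + v` with `v ⟂ x`. Reflections fixing `x` kill the odd powers of
`xᵀQv` and make the quadratic term proportional to `v·v`; summing over a basis determines the
constant. What remains are the means `M_s` of `(xᵀQx)^s`, related by `(d + 2s - 2) M_s = (k + 2s -
2) M_{s-1}` with `M_0 = 1`.

The results are `mean_bform`, `mean_bform_sq` and `mean_bform_cube`. Polarization in `y` turns
powers into products of coordinates of `P_j x`, and integrating the pointwise identities over `x =
X` gives the moment formulas. -/

theorem continuous_conj_left (P : Grassmannian k d) :
    Continuous fun U : Matrix.orthogonalGroup (Fin d) ℝ => conj U P :=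
  Continuous.subtype_mk (by
    have : Continuous fun U : Matrix.orthogonalGroup (Fin d) ℝ =>
      (U : Matrix (Fin d) (Fin d) ℝ) := continuous_subtype_val
    exact (this.matrix_mul continuous_const).matrix_mul this.matrix_transpose) _

theorem conj_conj (U V : Matrix.orthogonalGroup (Fin d) ℝ) (P : Grassmannian k d) :
    conj U (conj V P) = conj (U * V) P :=
  Subtype.ext (by simp [conj, Matrix.mul_assoc, Matrix.transpose_mul])

instance : IsProbabilityMeasure (haarO d) :=
  ⟨Measure.haarMeasure_self (K₀ := (⊤ : TopologicalSpace.PositiveCompacts _))⟩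

instance : (haarO d).IsMulLeftInvariant := by unfold haarO; infer_instance

instance (h : k ≤ d) : IsProbabilityMeasure (sigma h) :=
  Measure.isProbabilityMeasure_map (continuous_conj_left _).measurable.aemeasurable

theorem integral_sigma (h : k ≤ d) (f : C(Grassmannian k d, ℝ)) :
    ∫ Q, f Q ∂(sigma h) = ∫ U, f (conj U (diagProj h)) ∂(haarO d) :=
  integral_map (continuous_conj_left _).measurable.aemeasurable
    f.continuous.aestronglyMeasurable

theorem integrable_sigma (h : k ≤ d) (f : C(Grassmannian k d, ℝ)) :
    Integrable f (sigma h) := by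
  refine (integrable_map_measure f.continuous.aestronglyMeasurable
    (continuous_conj_left _).measurable.aemeasurable).2 ?_
  exact (f.continuous.comp (continuous_conj_left _)).integrable_of_hasCompactSupport
    (HasCompactSupport.of_compactSpace _)

/-- Integration against `σ_{k,d}` as a linear functional on continuous functions. -/
noncomputable def mean (h : k ≤ d) : C(Grassmannian k d, ℝ) →ₗ[ℝ] ℝ where
  toFun f := ∫ Q, f Q ∂(sigma h)
  map_add' f g := integral_add (integrable_sigma h f) (integrable_sigma h g)
  map_smul' c f := integral_const_mul c f

theorem mean_apply (h : k ≤ d) (f : C(Grassmannian k d, ℝ)) :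
    mean h f = ∫ Q, f Q ∂(sigma h) := rfl

theorem mean_one (h : k ≤ d) : mean h 1 = 1 := by
  simp [mean_apply]

theorem mean_eq_of_conj (h : k ≤ d) (U : Matrix.orthogonalGroup (Fin d) ℝ)
    {f g : C(Grassmannian k d, ℝ)} (hfg : ∀ Q, f (conj U Q) = g Q) : mean h f = mean h g := by
  rw [mean_apply, mean_apply, integral_sigma, integral_sigma]
  simp_rw [← hfg, conj_conj]
  exact (integral_mul_left_eq_self (fun V => f (conj V (diagProj h))) U).symm

/-! ### The forms `xᵀQy` on the Grassmannian. -/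

/-- The bilinear form `(x, y) ↦ xᵀ Q y` as a continuous function of the projector `Q`. -/
def bform (x y : Fin d → ℝ) : C(Grassmannian k d, ℝ) where
  toFun Q := x ⬝ᵥ Q.1 *ᵥ y
  continuous_toFun := by
    have : Continuous fun P : Grassmannian k d => P.1 := continuous_subtype_val
    exact continuous_const.dotProduct (this.matrix_mulVec continuous_const)

theorem bform_apply (x y : Fin d → ℝ) (Q : Grassmannian k d) :
    bform x y Q = x ⬝ᵥ Q.1 *ᵥ y := rfl

theorem bform_conj (U : Matrix.orthogonalGroup (Fin d) ℝ) (x y : Fin d → ℝ)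
    (Q : Grassmannian k d) :
    bform x y (conj U Q) = bform (U.1ᵀ *ᵥ x) (U.1ᵀ *ᵥ y) Q := by
  change x ⬝ᵥ (U.1 * Q.1 * U.1ᵀ) *ᵥ y = (U.1ᵀ *ᵥ x) ⬝ᵥ Q.1 *ᵥ (U.1ᵀ *ᵥ y)
  rw [← Matrix.mulVec_mulVec, ← Matrix.mulVec_mulVec, Matrix.dotProduct_mulVec x U.1,
    ← Matrix.mulVec_transpose]

theorem bform_add_left (x x' y : Fin d → ℝ) :
    (bform (x + x') y : C(Grassmannian k d, ℝ)) = bform x y + bform x' y := by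
  ext Q; simp [bform_apply]

theorem bform_smul_left (c : ℝ) (x y : Fin d → ℝ) :
    (bform (c • x) y : C(Grassmannian k d, ℝ)) = c • bform x y := by
  ext Q; simp [bform_apply]

theorem bform_comm (x y : Fin d → ℝ) : (bform x y : C(Grassmannian k d, ℝ)) = bform y x := by
  ext Q
  rw [bform_apply, bform_apply, dotProduct_comm, ← Matrix.vecMul_transpose, Q.2.1,
    Matrix.dotProduct_mulVec]

theorem bform_add_right (x y y' : Fin d → ℝ) :
    (bform x (y + y') : C(Grassmannian k d, ℝ)) = bform x y + bform x y' := by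
  simp only [bform_comm x, bform_add_left]

theorem bform_smul_right (c : ℝ) (x y : Fin d → ℝ) :
    (bform x (c • y) : C(Grassmannian k d, ℝ)) = c • bform x y := by
  simp only [bform_comm x, bform_smul_left]

theorem sum_bform_single_self :
    (∑ j, bform (Pi.single j 1) (Pi.single j 1) : C(Grassmannian k d, ℝ)) = (k : ℝ) • 1 := by
  ext Q
  simp [bform_apply, ContinuousMap.sum_apply, ← Q.2.2.2, Matrix.trace]

/-- Parseval for `Qx`, together with `|Qx|² = xᵀQx`. In the computation of the means, idempotency of
`Q` enters only here. -/
theorem sum_bform_single_sq (x : Fin d → ℝ) :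
    (∑ j, bform x (Pi.single j 1) ^ 2 : C(Grassmannian k d, ℝ)) = bform x x := by
  ext Q
  have h1 : x ⬝ᵥ Q.1 *ᵥ x = (Q.1 *ᵥ x) ⬝ᵥ (Q.1 *ᵥ x) := by
    conv_lhs => rw [← Q.2.2.1, ← Matrix.mulVec_mulVec, Matrix.dotProduct_mulVec,
      ← Matrix.mulVec_transpose, Q.2.1]
  simp only [bform_comm x]
  simp only [ContinuousMap.sum_apply, ContinuousMap.pow_apply, bform_apply, h1,
    single_one_dotProduct]
  simp [dotProduct, sq]

/-! ### Reflections and the means of `(xᵀQx)^s`. -/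

/-- Vectors of equal norm are exchanged by an orthogonal matrix fixing every vector
orthogonal to their difference. -/
theorem exists_orthogonal_mulVec_eq (a b : Fin d → ℝ) (hab : a ⬝ᵥ a = b ⬝ᵥ b) :
    ∃ U : Matrix.orthogonalGroup (Fin d) ℝ, U.1ᵀ *ᵥ a = b ∧
      ∀ w, w ⬝ᵥ a = w ⬝ᵥ b → U.1ᵀ *ᵥ w = w := by
  by_cases h : a = b
  · exact ⟨1, by simp [h], by simp⟩
  set v := a - b with hv
  have hvv : v ⬝ᵥ v ≠ 0 := fun h0 => h (sub_eq_zero.1 (dotProduct_self_eq_zero.1 h0))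
  -- The Householder reflection in the hyperplane orthogonal to `a - b`.
  set H : Matrix (Fin d) (Fin d) ℝ := 1 - (2 / (v ⬝ᵥ v)) • vecMulVec v v with hH
  have hT : Hᵀ = H := by
    simp [hH, Matrix.transpose_vecMulVec]
  have hmul (w : Fin d → ℝ) : H *ᵥ w = w - (2 * (v ⬝ᵥ w) / (v ⬝ᵥ v)) • v := by
    rw [hH, Matrix.sub_mulVec, Matrix.one_mulVec, Matrix.smul_mulVec, Matrix.vecMulVec_mulVec]
    ext i
    simp
    ring
  have hHH : H * H = 1 := by
    apply Matrix.toLin'.injective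
    ext1 i
    ext1
    simp only [LinearMap.comp_apply, Matrix.toLin'_apply, ← Matrix.mulVec_mulVec, hmul,
      dotProduct_sub, dotProduct_smul, Matrix.one_mulVec]
    ext j
    simp
    field_simp
    ring
  refine ⟨⟨H, (Matrix.mem_orthogonalGroup_iff (Fin d) ℝ).2 ?_⟩, ?_, ?_⟩
  · exact (congrArg (H * ·) hT).trans hHH
  · simp only [hT, hmul]
    have h2 : 2 * (v ⬝ᵥ a) = v ⬝ᵥ v := by
      simp only [hv, sub_dotProduct, dotProduct_sub]
      rw [dotProduct_comm b a]
      linarith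
    rw [h2, div_self hvv, one_smul, hv, sub_sub_cancel]
  · intro w hw
    have h0 : v ⬝ᵥ w = 0 := by
      rw [dotProduct_comm, hv, dotProduct_sub, hw, sub_self]
    simp [hT, hmul, h0]

theorem mean_bform_self_pow (h : k ≤ d) {x : Fin d → ℝ} (hx : x ⬝ᵥ x = 1) (y : Fin d → ℝ)
    (s : ℕ) : mean h (bform y y ^ s) = (y ⬝ᵥ y) ^ s * mean h (bform x x ^ s) := by
  have hy : 0 ≤ y ⬝ᵥ y := by simpa using dotProduct_star_self_nonneg y
  set r := √(y ⬝ᵥ y) with hr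
  have hr2 : r * r = y ⬝ᵥ y := Real.mul_self_sqrt hy
  obtain ⟨U, hU, -⟩ := exists_orthogonal_mulVec_eq y (r • x) (by
    simp [hx, hr2])
  rw [mean_eq_of_conj h U (g := bform (r • x) (r • x) ^ s) fun Q => by
    simp [bform_conj, hU]]
  rw [bform_smul_left, bform_smul_right, smul_smul, hr2, smul_pow, map_smul, smul_eq_mul]

theorem sum_single_dotProduct_sq {x : Fin d → ℝ} (hx : x ⬝ᵥ x = 1) :
    ∑ j, (x ⬝ᵥ Pi.single j 1) ^ 2 = 1 := by
  simp only [dotProduct_single_one, sq]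
  exact hx

theorem mean_bform_self (h : k ≤ d) {x : Fin d → ℝ} (hx : x ⬝ᵥ x = 1) :
    d * mean h (bform x x ^ 1) = k := by
  have h1 : mean h (∑ j, bform (Pi.single j 1) (Pi.single j 1) ^ 1) = k := by
    simp only [pow_one, sum_bform_single_self]
    simp [mean_one]
  rw [map_sum, Finset.sum_congr rfl fun j _ => mean_bform_self_pow h hx _ 1] at h1
  simpa using h1

/-- By invariance the mean of `(zᵀQz)²` is `(z·z)²` times a constant. Compare `t²` coefficients at
`z = x + te` for unit `e`, then sum over the standard basis. -/
theorem mean_bform_self_sq (h : k ≤ d) {x : Fin d → ℝ} (hx : x ⬝ᵥ x = 1) :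
    (d + 2) * mean h (bform x x ^ 2) = (k + 2) * mean h (bform x x ^ 1) := by
  have key (e : Fin d → ℝ) (he : e ⬝ᵥ e = 1) :
      mean h (bform x x * bform e e) + 2 * mean h (bform x e ^ 2)
        = (1 + 2 * (x ⬝ᵥ e) ^ 2) * mean h (bform x x ^ 2) := by
    -- The second difference at `t = -1, 0, 1`, with the `t⁴` term removed, isolates the `t²`
    -- coefficient.
    have hid : (4 : ℝ) • (bform x x * bform e e) + (8 : ℝ) • bform x e ^ 2 =
        (bform (x + e) (x + e) ^ 2 + bform (x + (-1 : ℝ) • e) (x + (-1 : ℝ) • e) ^ 2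
          - (2 : ℝ) • bform x x ^ 2 - (2 : ℝ) • bform e e ^ 2 : C(Grassmannian k d, ℝ)) := by
      simp only [bform_add_left, bform_add_right, bform_smul_left, bform_smul_right,
        bform_comm e x]
      ext Q
      simp
      ring
    have hm := congrArg (mean h) hid
    simp only [map_add, map_sub, map_smul, smul_eq_mul, mean_bform_self_pow h hx (x + _),
      mean_bform_self_pow h hx e, dotProduct_add, add_dotProduct, dotProduct_smul,
      smul_dotProduct, hx, he, dotProduct_comm e x] at hm
    linear_combination hm / 4
  have hsum := Finset.sum_congr rfl fun j (_ : j ∈ Finset.univ) =>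
    key (Pi.single j 1) (by simp)
  rw [Finset.sum_add_distrib, ← Finset.mul_sum, ← Finset.sum_mul, ← map_sum, ← map_sum,
    ← Finset.mul_sum, sum_bform_single_self, sum_bform_single_sq, Finset.sum_add_distrib,
    ← Finset.mul_sum, sum_single_dotProduct_sq hx] at hsum
  simp only [mul_smul_comm, mul_one, map_smul, smul_eq_mul, Finset.sum_const, Finset.card_univ,
    Fintype.card_fin, nsmul_eq_mul] at hsum
  rw [pow_one]
  linear_combination -hsum

theorem mean_bform_self_cube (h : k ≤ d) {x : Fin d → ℝ} (hx : x ⬝ᵥ x = 1) :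
    (d + 4) * mean h (bform x x ^ 3) = (k + 4) * mean h (bform x x ^ 2) := by
  have key (e : Fin d → ℝ) (he : e ⬝ᵥ e = 1) :
      mean h (bform x x ^ 2 * bform e e) + 4 * mean h (bform x x * bform x e ^ 2)
        = (1 + 4 * (x ⬝ᵥ e) ^ 2) * mean h (bform x x ^ 3) := by
    let g (t : ℝ) : C(Grassmannian k d, ℝ) := bform (x + t • e) (x + t • e) ^ 3
    -- The seven-point central stencil equals `180 g''(0)`: it is exact because `g` has degree 6 in
    -- `t`. The `t²` coefficient of `g` is `3(A²C + 4AB²)` with `A = xᵀQx`, `B = xᵀQe`, `C = eᵀQe`.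
    have hid : (1080 : ℝ) • (bform x x ^ 2 * bform e e)
          + (4320 : ℝ) • (bform x x * bform x e ^ 2) =
        (270 : ℝ) • (g 1 + g (-1)) - (27 : ℝ) • (g 2 + g (-2)) + (2 : ℝ) • (g 3 + g (-3))
          - (490 : ℝ) • bform x x ^ 3 := by
      simp only [g, bform_add_left, bform_add_right, bform_smul_left, bform_smul_right,
        bform_comm e x]
      ext Q
      simp
      ring
    have hm := congrArg (mean h) hid
    simp only [g, map_add, map_sub, map_smul, smul_eq_mul, mean_bform_self_pow h hx (x + _),
      dotProduct_add, add_dotProduct, dotProduct_smul,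
      smul_dotProduct, hx, he, dotProduct_comm e x] at hm
    linear_combination hm / 1080
  have hsum := Finset.sum_congr rfl fun j (_ : j ∈ Finset.univ) =>
    key (Pi.single j 1) (by simp)
  rw [Finset.sum_add_distrib, ← Finset.mul_sum, ← Finset.sum_mul, ← map_sum, ← map_sum,
    ← Finset.mul_sum, ← Finset.mul_sum, sum_bform_single_self, sum_bform_single_sq,
    Finset.sum_add_distrib, ← Finset.mul_sum, sum_single_dotProduct_sq hx] at hsum
  simp only [mul_smul_comm, mul_one, map_smul, smul_eq_mul, Finset.sum_const, Finset.card_univ,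
    Fintype.card_fin, nsmul_eq_mul, ← sq] at hsum
  linear_combination -hsum

/-! ### Mixed means and the means of `(xᵀQy)^s`. -/

theorem mean_mul_bform_odd_pow_eq_zero (h : k ≤ d) {x v : Fin d → ℝ} (hxv : x ⬝ᵥ v = 0)
    (m : ℕ) {s : ℕ} (hs : Odd s) : mean h (bform x x ^ m * bform x v ^ s) = 0 := by
  obtain ⟨U, hU, hfix⟩ := exists_orthogonal_mulVec_eq v ((-1 : ℝ) • v) (by simp)
  have h1 := mean_eq_of_conj h U (f := bform x x ^ m * bform x v ^ s)
    (g := (-1 : ℝ) • (bform x x ^ m * bform x v ^ s)) fun Q => by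
      have := hfix x (by simp [hxv])
      simp only [ContinuousMap.mul_apply, ContinuousMap.pow_apply, bform_conj, hU, this,
        ContinuousMap.smul_apply, bform_smul_right, smul_eq_mul, mul_pow, hs.neg_one_pow]
      ring
  rw [map_smul, smul_eq_mul] at h1
  linarith

/-- Any two vectors of equal norm orthogonal to `x` are exchanged by a reflection fixing `x`, so the
mean depends on `v` only through its norm. -/
theorem exists_mean_mul_bform_sq (h : k ≤ d) (x : Fin d → ℝ) (m : ℕ) :
    ∃ β : ℝ, ∀ v, x ⬝ᵥ v = 0 → mean h (bform x x ^ m * bform x v ^ 2) = v ⬝ᵥ v * β := by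
  by_cases hex : ∃ v₀, x ⬝ᵥ v₀ = 0 ∧ v₀ ≠ 0
  · obtain ⟨v₀, hxv₀, hv₀⟩ := hex
    have hv₀' : v₀ ⬝ᵥ v₀ ≠ 0 := fun h0 => hv₀ (dotProduct_self_eq_zero.1 h0)
    refine ⟨mean h (bform x x ^ m * bform x v₀ ^ 2) / (v₀ ⬝ᵥ v₀), fun v hxv => ?_⟩
    have hnn (y : Fin d → ℝ) : 0 ≤ y ⬝ᵥ y := by simpa using dotProduct_star_self_nonneg y
    set r := √(v ⬝ᵥ v / (v₀ ⬝ᵥ v₀)) with hr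
    have hr2 : r * r = v ⬝ᵥ v / (v₀ ⬝ᵥ v₀) := Real.mul_self_sqrt (div_nonneg (hnn _) (hnn _))
    obtain ⟨U, hU, hfix⟩ := exists_orthogonal_mulVec_eq v (r • v₀) (by
      rw [smul_dotProduct, dotProduct_smul, smul_smul, hr2, smul_eq_mul, div_mul_cancel₀ _ hv₀'])
    rw [mean_eq_of_conj h U (g := (r * r) • (bform x x ^ m * bform x v₀ ^ 2)) fun Q => by
      have := hfix x (by simp [hxv, hxv₀])
      simp only [ContinuousMap.mul_apply, ContinuousMap.pow_apply, bform_conj, hU, this,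
        ContinuousMap.smul_apply, bform_smul_right, smul_eq_mul]
      ring, map_smul, hr2, smul_eq_mul]
    ring
  -- Only possible for `d ≤ 1`: no nonzero vector is orthogonal to `x`.
  · refine ⟨0, fun v hv => ?_⟩
    have : v = 0 := by
      by_contra h0
      exact hex ⟨v, hv, h0⟩
    have h0 : (bform x (0 : Fin d → ℝ) : C(Grassmannian k d, ℝ)) = 0 := by
      ext Q; simp [bform_apply]
    simp [this, h0]

theorem exists_mean_mul_bform_sq_eq (h : k ≤ d) {x : Fin d → ℝ} (hx : x ⬝ᵥ x = 1) (m : ℕ) :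
    ∃ β : ℝ, (d - 1) * β = mean h (bform x x ^ (m + 1)) - mean h (bform x x ^ (m + 2)) ∧
      (∀ v, x ⬝ᵥ v = 0 → mean h (bform x x ^ m * bform x v ^ 2) = v ⬝ᵥ v * β) ∧
      ∀ y, mean h (bform x x ^ m * bform x y ^ 2) =
        (x ⬝ᵥ y) ^ 2 * mean h (bform x x ^ (m + 2)) + (y ⬝ᵥ y - (x ⬝ᵥ y) ^ 2) * β := by
  obtain ⟨β, hβ⟩ := exists_mean_mul_bform_sq h x m
  have key (y : Fin d → ℝ) : mean h (bform x x ^ m * bform x y ^ 2) =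
        (x ⬝ᵥ y) ^ 2 * mean h (bform x x ^ (m + 2)) + (y ⬝ᵥ y - (x ⬝ᵥ y) ^ 2) * β := by
    set v := y + (-(x ⬝ᵥ y)) • x with hv
    have hxv : x ⬝ᵥ v = 0 := by simp [hv, hx]
    have hy : y = (x ⬝ᵥ y) • x + v := by rw [hv]; module
    have hvv : v ⬝ᵥ v = y ⬝ᵥ y - (x ⬝ᵥ y) ^ 2 := by
      simp only [hv, add_dotProduct, dotProduct_add, smul_dotProduct, dotProduct_smul, hx,
        smul_eq_mul, dotProduct_comm y x]
      ring
    have hid : (bform x x ^ m * bform x y ^ 2 : C(Grassmannian k d, ℝ)) =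
        (x ⬝ᵥ y) ^ 2 • bform x x ^ (m + 2)
          + (2 * (x ⬝ᵥ y)) • (bform x x ^ (m + 1) * bform x v ^ 1)
          + bform x x ^ m * bform x v ^ 2 := by
      conv_lhs => rw [hy, bform_add_right, bform_smul_right]
      ext Q
      simp
      ring
    rw [hid, map_add, map_add, map_smul, map_smul,
      mean_mul_bform_odd_pow_eq_zero h hxv _ odd_one, hβ v hxv, hvv]
    simp
  refine ⟨β, ?_, hβ, key⟩
  -- Summing over the basis collapses the left side to the mean of `(xᵀQx)^(m+1)` and leaves `(d -
  -- 1)β` on the right.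
  have hsum := Finset.sum_congr rfl fun j (_ : j ∈ Finset.univ) => key (Pi.single j 1)
  rw [← map_sum, ← Finset.mul_sum, sum_bform_single_sq, Finset.sum_add_distrib,
    ← Finset.sum_mul, ← Finset.sum_mul, Finset.sum_sub_distrib,
    sum_single_dotProduct_sq hx, ← pow_succ] at hsum
  simp at hsum
  linear_combination -hsum

theorem mean_bform (h : k ≤ d) {x : Fin d → ℝ} (hx : x ⬝ᵥ x = 1) (y : Fin d → ℝ) :
    d * mean h (bform x y) = k * (x ⬝ᵥ y) := by
  set v := y + (-(x ⬝ᵥ y)) • x with hv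
  have hxv : x ⬝ᵥ v = 0 := by simp [hv, hx]
  have hy : y = (x ⬝ᵥ y) • x + v := by rw [hv]; module
  have h0 := mean_mul_bform_odd_pow_eq_zero h hxv 0 odd_one
  have h1 := mean_bform_self h hx
  have h2 : mean h (bform x y) = (x ⬝ᵥ y) * mean h (bform x x) := by
    conv_lhs => rw [hy, bform_add_right, bform_smul_right]
    simpa using h0
  rw [pow_one] at h1
  rw [h2]
  linear_combination (x ⬝ᵥ y) * h1

theorem mean_bform_sq (h : k ≤ d) {x : Fin d → ℝ} (hx : x ⬝ᵥ x = 1) (y : Fin d → ℝ) :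
    ((d - 1) * d * (d + 2)) * mean h (bform x y ^ 2) =
      k * (d * k + d - 2) * (x ⬝ᵥ y) ^ 2 + k * (d - k) * (y ⬝ᵥ y) := by
  obtain ⟨β, hβ, -, hy⟩ := exists_mean_mul_bform_sq_eq h hx 0
  have h1 := mean_bform_self h hx
  have h2 := mean_bform_self_sq h hx
  have h3 := hy y
  simp only [pow_zero, one_mul, zero_add] at h3 hβ
  rw [h3]
  set ξ := x ⬝ᵥ y
  set η := y ⬝ᵥ y
  linear_combination (d * (d + 2) * (η - ξ ^ 2)) * hβ
    + (d * (ξ ^ 2 * (d - 1) - (η - ξ ^ 2))) * h2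
    + ((d + 2) * (η - ξ ^ 2) + (k + 2) * (ξ ^ 2 * (d - 1) - (η - ξ ^ 2))) * h1

theorem mean_bform_cube (h : k ≤ d) {x : Fin d → ℝ} (hx : x ⬝ᵥ x = 1) (y : Fin d → ℝ) :
    ((d - 1) * d * (d + 2) * (d + 4)) * mean h (bform x y ^ 3) =
      k * (k + 2) * (k * d + 2 * k + d - 4) * (x ⬝ᵥ y) ^ 3
        + 3 * k * (k + 2) * (d - k) * (x ⬝ᵥ y) * (y ⬝ᵥ y) := by
  obtain ⟨β, hβ, hv2, -⟩ := exists_mean_mul_bform_sq_eq h hx 1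
  have h1 := mean_bform_self h hx
  have h2 := mean_bform_self_sq h hx
  have h3 := mean_bform_self_cube h hx
  set v := y + (-(x ⬝ᵥ y)) • x with hv
  have hxv : x ⬝ᵥ v = 0 := by simp [hv, hx]
  have hy : y = (x ⬝ᵥ y) • x + v := by rw [hv]; module
  have hvv : v ⬝ᵥ v = y ⬝ᵥ y - (x ⬝ᵥ y) ^ 2 := by
    simp only [hv, add_dotProduct, dotProduct_add, smul_dotProduct, dotProduct_smul, hx,
      smul_eq_mul, dotProduct_comm y x]
    ring
  have hid : (bform x y ^ 3 : C(Grassmannian k d, ℝ)) =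
      (x ⬝ᵥ y) ^ 3 • bform x x ^ 3
        + (3 * (x ⬝ᵥ y) ^ 2) • (bform x x ^ 2 * bform x v ^ 1)
        + (3 * (x ⬝ᵥ y)) • (bform x x ^ 1 * bform x v ^ 2)
        + bform x x ^ 0 * bform x v ^ 3 := by
    conv_lhs => rw [hy, bform_add_right, bform_smul_right]
    ext Q
    simp
    ring
  rw [hid, map_add, map_add, map_add, map_smul, map_smul, map_smul,
    mean_mul_bform_odd_pow_eq_zero h hxv _ odd_one,
    mean_mul_bform_odd_pow_eq_zero h hxv 0 (s := 3) (by decide), hv2 v hxv, hvv]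
  simp only [smul_eq_mul, Nat.reduceAdd] at hβ ⊢
  set ξ := x ⬝ᵥ y
  set η := y ⬝ᵥ y
  set M3 := mean h (bform x x ^ 3)
  set M2 := mean h (bform x x ^ 2)
  set M1 := mean h (bform x x ^ 1)
  linear_combination (3 * ξ * (η - ξ ^ 2) * d * (d + 2) * (d + 4)) * hβ
    + ((ξ ^ 3 * (d - 1) - 3 * ξ * (η - ξ ^ 2)) * d * (d + 2)) * h3
    + (3 * ξ * (η - ξ ^ 2) * (d + 4) + (k + 4) * (ξ ^ 3 * (d - 1) - 3 * ξ * (η - ξ ^ 2)))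
      * (d * h2 + (k + 2) * h1)

/-! ### From cubatures to means. -/

theorem rank_add_le (A B : Matrix (Fin d) (Fin d) ℝ) : (A + B).rank ≤ A.rank + B.rank := by
  unfold Matrix.rank
  rw [Matrix.mulVecLin_add]
  refine (Submodule.finrank_mono ?_).trans
    (Submodule.finrank_add_le_finrank_add_finrank A.mulVecLin.range B.mulVecLin.range)
  rintro _ ⟨v, rfl⟩
  exact Submodule.add_mem_sup ⟨v, rfl⟩ ⟨v, rfl⟩

/-- Symmetrizing the rank-one matrix `xyᵀ` costs rank 2, which is why `Pol²` is the right space. -/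
theorem bform_pow_mem_Pol (x y : Fin d → ℝ) {s t : ℕ} (hst : s ≤ t) :
    (fun Q => bform x y Q ^ s) ∈ Pol k d 2 t := by
  refine Submodule.subset_span ⟨(1 / 2 : ℝ) • (vecMulVec x y + vecMulVec y x), ?_, ?_, s, hst, ?_⟩
  · simp [Matrix.IsSymm, Matrix.transpose_vecMulVec, add_comm]
  · rw [smul_add, ← Matrix.smul_vecMulVec, ← Matrix.smul_vecMulVec]
    exact (rank_add_le _ _).trans
      (add_le_add (Matrix.rank_vecMulVec_le _ _) (Matrix.rank_vecMulVec_le _ _))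
  · funext Q
    have h1 (u v : Fin d → ℝ) : (vecMulVec u v * Q.1).trace = bform v u Q := by
      rw [Matrix.vecMulVec_mul, Matrix.trace_vecMulVec, dotProduct_comm,
        ← Matrix.dotProduct_mulVec, bform_apply]
    rw [Matrix.smul_mul, Matrix.trace_smul, Matrix.add_mul, Matrix.trace_add, h1, h1,
      bform_comm y x, smul_eq_mul]
    ring

theorem IsCubature.sum_bform_pow {h : k ≤ d} {t : ℕ} {P : Fin n → Grassmannian k d}
    {w : Fin n → ℝ} (hP : IsCubature h 2 t P w) (x y : Fin d → ℝ) {s : ℕ} (hst : s ≤ t) :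
    ∑ j, w j * bform x y (P j) ^ s = mean h (bform x y ^ s) :=
  hP _ (bform_pow_mem_Pol x y hst)

theorem IsCubature.mono {h : k ≤ d} {l s t : ℕ} (hst : s ≤ t) {P : Fin n → Grassmannian k d}
    {w : Fin n → ℝ} (hP : IsCubature h l t P w) : IsCubature h l s P w := by
  refine fun f hf => hP f (Submodule.span_mono ?_ hf)
  rintro _ ⟨M, hM, hr, r, hrs, hg⟩
  exact ⟨M, hM, hr, r, hrs.trans hst, hg⟩

theorem projCoord_eq_bform (P : Grassmannian k d) (x : EuclideanSpace ℝ (Fin d)) (i : Fin d) :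
    projCoord P x i = bform x.ofLp (Pi.single i 1) P := by
  rw [bform_comm, bform_apply, single_one_dotProduct, projCoord]

theorem single_dotProduct_single_eq_delta (i l : Fin d) :
    (Pi.single i 1 : Fin d → ℝ) ⬝ᵥ Pi.single l 1 = delta i l := by
  rw [single_one_dotProduct, Pi.single_apply, delta]

theorem delta_self (i : Fin d) : delta i i = 1 := if_pos rfl

theorem delta_comm (i l : Fin d) : delta i l = delta l i := by simp only [delta, eq_comm]

theorem continuous_projCoord (P : Grassmannian k d) (i : Fin d) :
    Continuous fun x => projCoord P x i := by
  have h : Continuous fun x : EuclideanSpace ℝ (Fin d) => x.ofLp := PiLp.continuous_ofLp 2 _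
  exact (continuous_apply i).comp (continuous_const.matrix_mulVec h)

theorem integrable_comp_of_mem_sphere {E : Type*} [NormedAddCommGroup E] [ProperSpace E]
    [MeasurableSpace E] [BorelSpace E] {Ω : Type*} [MeasurableSpace Ω]
    {μ : Measure Ω} [IsFiniteMeasure μ] {X : Ω → E} (hX : AEMeasurable X μ)
    (hs : ∀ᵐ a ∂μ, X a ∈ Metric.sphere (0 : E) 1) {f : E → ℝ} (hf : Continuous f) :
    Integrable (fun a => f (X a)) μ := by
  obtain ⟨C, hC⟩ := (isCompact_sphere (0 : E) 1).exists_bound_of_continuousOn hf.continuousOn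
  refine Integrable.of_bound (hf.measurable.comp_aemeasurable hX).aestronglyMeasurable C ?_
  filter_upwards [hs] with a ha using hC _ ha

theorem dotProduct_self_of_mem_sphere {x : EuclideanSpace ℝ (Fin d)}
    (hx : x ∈ Metric.sphere (0 : EuclideanSpace ℝ (Fin d)) 1) : x.ofLp ⬝ᵥ x.ofLp = 1 := by
  have h := EuclideanSpace.real_norm_sq_eq x
  rw [mem_sphere_zero_iff_norm.1 hx, one_pow] at h
  simpa [dotProduct, sq] using h.symm

/-! ### Coordinate identities at a fixed unit vector, by polarization. -/

section Pointwise

variable {h : k ≤ d} {P : Fin n → Grassmannian k d} {w : Fin n → ℝ}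
  {x : EuclideanSpace ℝ (Fin d)}

theorem IsCubature.sum_projCoord (hP : IsCubature h 2 1 P w) (hx : x.ofLp ⬝ᵥ x.ofLp = 1)
    (i : Fin d) : d * ∑ j, w j * projCoord (P j) x i = k * x i := by
  have h1 := hP.sum_bform_pow x.ofLp (Pi.single i 1) le_rfl
  simp only [pow_one] at h1
  simp only [projCoord_eq_bform, h1, mean_bform h hx, dotProduct_single_one]

theorem IsCubature.sum_projCoord_mul (hP : IsCubature h 2 2 P w) (hx : x.ofLp ⬝ᵥ x.ofLp = 1)
    (i l : Fin d) :
    ((d - 1) * d * (d + 2)) * ∑ j, w j * (projCoord (P j) x i * projCoord (P j) x l) =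
      k * (d * k + d - 2) * (x i * x l) + k * (d - k) * delta i l := by
  let e (i : Fin d) : Fin d → ℝ := Pi.single i 1
  have hxe (r : Fin d) : x.ofLp ⬝ᵥ Pi.single r 1 = x r := dotProduct_single_one _ _
  have key (y : Fin d → ℝ) := (hP.sum_bform_pow x.ofLp y le_rfl).symm ▸ mean_bform_sq h hx y
  have hpol : ∑ j, w j * (projCoord (P j) x i * projCoord (P j) x l) =
      (∑ j, w j * bform x.ofLp (e i + e l) (P j) ^ 2 - ∑ j, w j * bform x.ofLp (e i) (P j) ^ 2
        - ∑ j, w j * bform x.ofLp (e l) (P j) ^ 2) / 2 := by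
    rw [← Finset.sum_sub_distrib, ← Finset.sum_sub_distrib, Finset.sum_div]
    refine Finset.sum_congr rfl fun j _ => ?_
    rw [projCoord_eq_bform, projCoord_eq_bform, bform_add_right, ContinuousMap.add_apply]
    ring
  have h1 := key (e i + e l)
  have h2 := key (e i)
  have h3 := key (e l)
  rw [hpol]
  simp only [e, dotProduct_add, add_dotProduct, single_dotProduct_single_eq_delta, delta_self,
    hxe, delta_comm l i] at h1 h2 h3 ⊢
  linear_combination (h1 - h2 - h3) / 2

theorem IsCubature.sum_projCoord_mul_mul (hP : IsCubature h 2 3 P w)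
    (hx : x.ofLp ⬝ᵥ x.ofLp = 1) (i l m : Fin d) :
    ((d - 1) * d * (d + 2) * (d + 4)) *
        ∑ j, w j * (projCoord (P j) x i * projCoord (P j) x l * projCoord (P j) x m) =
      k * (k + 2) * (k * d + 2 * k + d - 4) * (x i * x l * x m)
        + k * (k + 2) * (d - k) * (x i * delta l m + x l * delta i m + x m * delta i l) := by
  let e (i : Fin d) : Fin d → ℝ := Pi.single i 1
  have hxe (r : Fin d) : x.ofLp ⬝ᵥ Pi.single r 1 = x r := dotProduct_single_one _ _
  let S (y : Fin d → ℝ) : ℝ := ∑ j, w j * bform x.ofLp y (P j) ^ 3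
  have key (y : Fin d → ℝ) : ((d - 1) * d * (d + 2) * (d + 4)) * S y = _ :=
    (hP.sum_bform_pow x.ofLp y le_rfl).symm ▸ mean_bform_cube h hx y
  -- Inclusion-exclusion on `(a + b + c)³` leaves `6abc`.
  have hpol : ∑ j, w j * (projCoord (P j) x i * projCoord (P j) x l * projCoord (P j) x m) =
      (S (e i + e l + e m) - S (e i + e l) - S (e i + e m) - S (e l + e m)
        + S (e i) + S (e l) + S (e m)) / 6 := by
    simp only [S]
    rw [← Finset.sum_sub_distrib, ← Finset.sum_sub_distrib, ← Finset.sum_sub_distrib,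
      ← Finset.sum_add_distrib, ← Finset.sum_add_distrib, ← Finset.sum_add_distrib,
      Finset.sum_div]
    refine Finset.sum_congr rfl fun j _ => ?_
    simp only [projCoord_eq_bform, bform_add_right, ContinuousMap.add_apply, e]
    ring
  have h1 := key (e i + e l + e m)
  have h2 := key (e i + e l)
  have h3 := key (e i + e m)
  have h4 := key (e l + e m)
  have h5 := key (e i)
  have h6 := key (e l)
  have h7 := key (e m)
  rw [hpol]
  simp only [e, dotProduct_add, add_dotProduct, single_dotProduct_single_eq_delta, delta_self,
    hxe, delta_comm l i, delta_comm m i, delta_comm m l]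
    at h1 h2 h3 h4 h5 h6 h7 ⊢
  linear_combination (h1 - h2 - h3 - h4 + h5 + h6 + h7) / 6

end Pointwise

/-! ### Integration over the random vector. -/

section Moments

variable {Ω : Type*} [MeasurableSpace Ω] {μ : Measure Ω} [IsProbabilityMeasure μ]
  {X : Ω → EuclideanSpace ℝ (Fin d)} {h : k ≤ d} {P : Fin n → Grassmannian k d} {w : Fin n → ℝ}

theorem IsCubature.firstMoments (hd : 3 ≤ d) (hk : 1 ≤ k) (hX : AEMeasurable X μ)
    (hs : ∀ᵐ a ∂μ, X a ∈ Metric.sphere (0 : EuclideanSpace ℝ (Fin d)) 1)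
    (hP : IsCubature h 2 1 P w) : FirstMoments μ X P w := by
  have hd' : (3 : ℝ) ≤ d := mod_cast hd
  have hk' : (1 : ℝ) ≤ k := mod_cast hk
  intro i
  have hint (j : Fin n) : Integrable (fun a => w j * projCoord (P j) (X a) i) μ :=
    integrable_comp_of_mem_sphere hX hs (f := fun x => w j * projCoord (P j) x i)
      (continuous_const.mul (continuous_projCoord _ _))
  simp_rw [← integral_const_mul (w _)]
  rw [← integral_finsetSum _ fun j _ => hint j, ← integral_const_mul]
  refine integral_congr_ae ?_
  filter_upwards [hs] with a ha
  have h1 := hP.sum_projCoord (dotProduct_self_of_mem_sphere ha) i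
  rw [A1]
  field_simp
  linarith

theorem IsCubature.secondMoments (hd : 3 ≤ d) (hk : 1 ≤ k) (hX : AEMeasurable X μ)
    (hs : ∀ᵐ a ∂μ, X a ∈ Metric.sphere (0 : EuclideanSpace ℝ (Fin d)) 1)
    (hP : IsCubature h 2 2 P w) : SecondMoments μ X P w := by
  have hd' : (3 : ℝ) ≤ d := mod_cast hd
  have hk' : (1 : ℝ) ≤ k := mod_cast hk
  intro i l
  have hint (j : Fin n) : Integrable
      (fun a => w j * (projCoord (P j) (X a) i * projCoord (P j) (X a) l)) μ :=
    integrable_comp_of_mem_sphere hX hs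
      (f := fun x => w j * (projCoord (P j) x i * projCoord (P j) x l))
      (continuous_const.mul ((continuous_projCoord _ _).mul (continuous_projCoord _ _)))
  simp_rw [← integral_const_mul (w _)]
  rw [← integral_finsetSum _ fun j _ => hint j, ← integral_const_mul]
  have hc : B2 d k * ((k : ℝ) / d) * delta i l
      = ∫ _, B2 d k * ((k : ℝ) / d) * delta i l ∂μ := by simp
  rw [hc, ← integral_sub ((integrable_finsetSum _ fun j _ => hint j).const_mul _)
    (integrable_const _)]
  refine integral_congr_ae ?_
  filter_upwards [hs] with a ha
  have h1 := hP.sum_projCoord_mul (dotProduct_self_of_mem_sphere ha) i l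
  have hpos : (0 : ℝ) < d * k + d - 2 := by nlinarith
  have hB : B2 d k * ((k : ℝ) / d) = (d - k) / (d * k + d - 2) := by
    have : (k : ℝ) * d * (k + 1) - 2 * k = k * (d * k + d - 2) := by ring
    rw [B2, this]
    field_simp
  rw [hB, A2, div_mul_eq_mul_div, h1]
  generalize (d * k + d - 2 : ℝ) = D at hpos ⊢
  field_simp
  ring

theorem IsCubature.thirdMoments (hd : 3 ≤ d) (hk : 1 ≤ k) (hX : AEMeasurable X μ)
    (hs : ∀ᵐ a ∂μ, X a ∈ Metric.sphere (0 : EuclideanSpace ℝ (Fin d)) 1)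
    (hP : IsCubature h 2 3 P w) : ThirdMoments μ X P w := by
  have hd' : (3 : ℝ) ≤ d := mod_cast hd
  have hk' : (1 : ℝ) ≤ k := mod_cast hk
  intro i l m
  have hint (j : Fin n) : Integrable (fun a =>
      w j * (projCoord (P j) (X a) i * projCoord (P j) (X a) l * projCoord (P j) (X a) m)) μ :=
    integrable_comp_of_mem_sphere hX hs
      (f := fun x => w j * (projCoord (P j) x i * projCoord (P j) x l * projCoord (P j) x m))
      (continuous_const.mul (((continuous_projCoord _ _).mul (continuous_projCoord _ _)).mul
        (continuous_projCoord _ _)))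
  have hcoord (r : Fin d) : Integrable (fun a => X a r) μ :=
    integrable_comp_of_mem_sphere hX hs (f := fun x : EuclideanSpace ℝ (Fin d) => x r)
      (by fun_prop)
  have hi := (hcoord i).mul_const (delta l m)
  have hl := (hcoord l).mul_const (delta i m)
  have hm := (hcoord m).mul_const (delta i l)
  have hil : Integrable (fun a => X a i * delta l m + X a l * delta i m) μ := hi.add hl
  have hilm : Integrable
      (fun a => X a i * delta l m + X a l * delta i m + X a m * delta i l) μ := hil.add hm
  have hfirst (r : Fin d) : ∑ j, w j * ∫ a, projCoord (P j) (X a) r ∂μ =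
      k / d * ∫ a, X a r ∂μ := by
    rw [(hP.mono (by norm_num : 1 ≤ 3)).firstMoments hd hk hX hs r, A1]
    field_simp
  -- One factor `k/d` is explicit in the formula; the other comes from replacing projected first
  -- moments by those of `X`.
  have hlin : ∑ j, w j * ((∫ a, projCoord (P j) (X a) i ∂μ) * delta l m
            + (∫ a, projCoord (P j) (X a) l ∂μ) * delta i m
            + (∫ a, projCoord (P j) (X a) m ∂μ) * delta i l) * ((k : ℝ) / (d : ℝ)) =
      ∫ a, (k / d : ℝ) ^ 2 * (X a i * delta l m + X a l * delta i m + X a m * delta i l) ∂μ := by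
    rw [integral_const_mul, integral_add hil hm, integral_add hi hl,
      integral_mul_const, integral_mul_const, integral_mul_const]
    calc _ = ((∑ j, w j * ∫ a, projCoord (P j) (X a) i ∂μ) * delta l m
          + (∑ j, w j * ∫ a, projCoord (P j) (X a) l ∂μ) * delta i m
          + (∑ j, w j * ∫ a, projCoord (P j) (X a) m ∂μ) * delta i l) * ((k : ℝ) / d) := by
          simp only [Finset.sum_mul, ← Finset.sum_add_distrib]
          exact Finset.sum_congr rfl fun j _ => by ring
      _ = _ := by rw [hfirst, hfirst, hfirst]; ring
  rw [hlin]
  simp_rw [← integral_const_mul (w _)]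
  rw [← integral_finsetSum _ fun j _ => hint j, ← integral_const_mul, ← integral_const_mul,
    ← integral_sub ((integrable_finsetSum _ fun j _ => hint j).const_mul _)
    ((hilm.const_mul _).const_mul _)]
  refine integral_congr_ae ?_
  filter_upwards [hs] with a ha
  have h1 := hP.sum_projCoord_mul_mul (dotProduct_self_of_mem_sphere ha) i l m
  have hpos : (0 : ℝ) < k * d + 2 * k + d - 4 := by nlinarith
  have hd2 : (0 : ℝ) < d - 2 := by linarith
  -- The stated constants carry the factor `d - 2` above and below; it cancels since `d ≥ 3`,
  -- leaving those of `mean_bform_cube`.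
  have hden : (d : ℝ) ^ 2 * k ^ 2 + 3 * d ^ 2 * k + 2 * d ^ 2 - 6 * d * k - 12 * d - 4 * k ^ 2 + 16
      = (d - 2) * (k + 2) * (k * d + 2 * k + d - 4) := by ring
  have hB : B3 d k / 3 * (k / d : ℝ) ^ 2 = (d - k) / (k * d + 2 * k + d - 4) := by
    have : (d : ℝ) ^ 2 * k + 2 * d ^ 2 - d * k ^ 2 - 4 * d * k - 4 * d + 2 * k ^ 2 + 4 * k
        = (d - 2) * (k + 2) * (d - k) := by ring
    rw [B3, hden, this]
    field_simp
  have hA : A3 d k = ((d - 1) * d * (d + 2) * (d + 4)) /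
      (k * (k + 2) * (k * d + 2 * k + d - 4)) := by
    rw [A3, hden]
    field_simp
  rw [← mul_assoc (B3 d k / 3), hB, hA, div_mul_eq_mul_div, h1]
  generalize (k * d + 2 * k + d - 4 : ℝ) = D at hpos ⊢
  field_simp
  ring

end Moments

end MomentFusion

theorem corollary2p5 {k d : ℕ} (hd : 3 ≤ d) (hk : 1 ≤ k) (hkd : k < d)
    {Ω : Type*} [MeasurableSpace Ω] (μ : MeasureTheory.Measure Ω)
    [MeasureTheory.IsProbabilityMeasure μ]
    (X : Ω → EuclideanSpace ℝ (Fin d)) (hX : AEMeasurable X μ)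
    (hsphere : ∀ᵐ a ∂μ, X a ∈ Metric.sphere (0 : EuclideanSpace ℝ (Fin d)) 1)
    {n : ℕ} (P : Fin n → MomentFusion.Grassmannian k d) (w : Fin n → ℝ) :
    (MomentFusion.IsCubature hkd.le 2 1 P w → MomentFusion.FirstMoments μ X P w) ∧
    (MomentFusion.IsCubature hkd.le 2 2 P w →
      MomentFusion.FirstMoments μ X P w ∧ MomentFusion.SecondMoments μ X P w) ∧
    (MomentFusion.IsCubature hkd.le 2 3 P w →
      MomentFusion.FirstMoments μ X P w ∧ MomentFusion.SecondMoments μ X P w ∧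
        MomentFusion.ThirdMoments μ X P w) :=
  ⟨fun h => h.firstMoments hd hk hX hsphere,
    fun h => ⟨(h.mono (by norm_num)).firstMoments hd hk hX hsphere,
      h.secondMoments hd hk hX hsphere⟩,
    fun h => ⟨(h.mono (by norm_num)).firstMoments hd hk hX hsphere,
      (h.mono (by norm_num)).secondMoments hd hk hX hsphere,
      h.thirdMoments hd hk hX hsphere⟩⟩
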